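/- Let $2^{\mathbb N}$ be the Cantor space, endowed with the metric $d(\sigma,\tau)=1/n$, where $n$ is the least positive integer with $\sigma(n)\neq\tau(n)$, and $d(\sigma,\sigma)=0$. Let $\mathrm{Homeo}(2^{\mathbb N})$ be the group of all homeomorphisms of $2^{\mathbb N}$ onto itself, with the metric $\tilde d(f,g)=\max_{\sigma} d(f(\sigma),g(\sigma))$. Let $h$ be an element of the comeager conjugacy class of $\mathrm{Homeo}(2^{\mathbb N})$, that is, $h$ belongs to a conjugacy class $C$ of this group that is a comeager subset of it. A point $\sigma$ is recurrent for $h$ if $\sigma$ is a limit point of the sequence $(h^n(\sigma))_{n\in\mathbb N}$, that is, every neighbourhood of $\sigma$ contains $h^n(\sigma)$ for infinitely many $n$. The map $h$ is chain continuous at $\sigma$ if for every $\varepsilon>0$ there is $\delta>0$ such that every sequence $(\sigma_n)_{n\ge 0}$ with $d(\sigma_0,\sigma)<\delta$ and $d(\sigma_{n+1},h(\sigma_n))<\delta$ for all $n\ge 0$ satisfies $d(\sigma_n,h^n(\sigma))<\varepsilon$ for all $n\ge 0$. The map $h$ is equicontinuous at $\sigma$ if for every $\varepsilon>0$ there is $\delta>0$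 such that $d(\tau,\sigma)<\delta$ implies $d(h^n(\tau),h^n(\sigma))<\varepsilon$ for all $n\ge 0$. Then: 1. $h$ is chain continuous at every nonrecurrent point; 2. there is a dense open set $U\subseteq 2^{\mathbb N}$ such that $h$ is chain continuous at every point of $U$; 3. there is an uncountable set $A\subseteq 2^{\mathbb N}$ such that $h$ is not equicontinuous at any point of $A$. -/

import Mathlib

open Set Filter Topology Uniformity

/-- The Cantor space `2^ℕ`, with the product topology of the discrete two-point space. -/
abbrev Cantor : Type := ℕ → Bool

open Classical in
/-- `d(σ, τ) = 1 / n`, where `n` is the least positive integer such that the `n`-th terms of `σ`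
and `τ` differ, and `d(σ, σ) = 0`. Terms are indexed from `0` here, whence the `+ 1`. -/
noncomputable def cantorDist (σ τ : Cantor) : ℝ :=
  if σ = τ then 0 else 1 / ((PiNat.firstDiff σ τ : ℝ) + 1)

theorem cantorDist_self (σ : Cantor) : cantorDist σ σ = 0 := by
  simp [cantorDist]

theorem cantorDist_comm (σ τ : Cantor) : cantorDist σ τ = cantorDist τ σ := by
  by_cases h : σ = τ
  · rw [h]
  · rw [cantorDist, cantorDist, if_neg h, if_neg (Ne.symm h), PiNat.firstDiff_comm]

theorem cantorDist_eq {σ τ : Cantor} (h : cantorDist σ τ = 0) : σ = τ := by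
  by_contra hne
  rw [cantorDist, if_neg hne] at h
  have : (0 : ℝ) < 1 / ((PiNat.firstDiff σ τ : ℝ) + 1) := by positivity
  exact this.ne' h

theorem cantorDist_nonneg (σ τ : Cantor) : 0 ≤ cantorDist σ τ := by
  unfold cantorDist
  split_ifs <;> positivity

/-- Two points are at distance less than `1 / n` exactly when their first `n` terms agree. -/
theorem cantorDist_lt_iff (σ τ : Cantor) (n : ℕ) :
    cantorDist σ τ < 1 / ((n : ℝ) + 1) ↔ ∀ i ≤ n, σ i = τ i := by
  by_cases hne : σ = τ
  · subst hne
    simp only [cantorDist_self, implies_true, iff_true]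
    positivity
  · rw [cantorDist, if_neg hne, one_div_lt_one_div (by positivity) (by positivity)]
    simp only [add_lt_add_iff_right, Nat.cast_lt]
    constructor
    · intro h i hi
      exact PiNat.apply_eq_of_lt_firstDiff (lt_of_le_of_lt hi h)
    · intro h
      by_contra hlt
      exact PiNat.apply_firstDiff_ne hne (h _ (not_lt.mp hlt))

theorem cantorDist_triangle (σ τ ρ : Cantor) :
    cantorDist σ ρ ≤ cantorDist σ τ + cantorDist τ ρ := by
  by_cases h1 : σ = ρ
  · subst h1
    rw [cantorDist_self]
    exact add_nonneg (cantorDist_nonneg _ _) (cantorDist_nonneg _ _)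
  by_cases h2 : σ = τ
  · subst h2
    rw [cantorDist_self, zero_add]
  by_cases h3 : τ = ρ
  · subst h3
    rw [cantorDist_self, add_zero]
  have p1 := cantorDist_nonneg σ τ
  have p2 := cantorDist_nonneg τ ρ
  rcases min_le_iff.1 (PiNat.min_firstDiff_le σ τ ρ h1) with h | h
  · have : cantorDist σ ρ ≤ cantorDist σ τ := by
      rw [cantorDist, cantorDist, if_neg h1, if_neg h2]
      gcongr
    linarith
  · have : cantorDist σ ρ ≤ cantorDist τ ρ := by
      rw [cantorDist, cantorDist, if_neg h1, if_neg h3]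
      gcongr
    linarith

/-- The Cantor space as a metric space with distance `cantorDist`. The topology and the uniform
structure that come with it are by definition the product ones. -/
noncomputable instance cantorMetricSpace : MetricSpace Cantor where
  dist := cantorDist
  dist_self := cantorDist_self
  dist_comm := cantorDist_comm
  dist_triangle := cantorDist_triangle
  eq_of_dist_eq_zero := cantorDist_eq
  toUniformSpace := Pi.uniformSpace _
  uniformity_dist := by
    have hB : 𝓤 Bool = 𝓟 SetRel.id := rfl
    simp only [Pi.uniformity, hB, SetRel.id, comap_principal, preimage_ofPred_eq]
    apply le_antisymm
    · simp only [le_iInf_iff, le_principal_iff]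
      intro ε εpos
      obtain ⟨n, hn⟩ := exists_nat_one_div_lt εpos
      apply @mem_iInf_of_iInter _ _ _ _ _ (Finset.range (n + 1)).finite_toSet fun i =>
        { p : Cantor × Cantor | p.fst i = p.snd i }
      · simp only [mem_principal, ofPred_subset_ofPred, imp_self, imp_true_iff]
      · rintro ⟨x, y⟩ hxy
        simp only [Finset.mem_coe, Finset.mem_range, iInter_coe_set, mem_iInter, mem_ofPred_eq]
          at hxy
        exact lt_trans ((cantorDist_lt_iff x y n).2 fun i hi => hxy i (by omega)) hn
    · simp only [le_iInf_iff, le_principal_iff]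
      intro n
      refine mem_iInf_of_mem (1 / ((n : ℝ) + 1)) ?_
      refine mem_iInf_of_mem (by positivity) ?_
      simp only [mem_principal, ofPred_subset_ofPred, Prod.forall]
      intro x y hxy
      exact (cantorDist_lt_iff x y n).1 hxy n le_rfl

/-- The space of homeomorphisms of the Cantor space with the metric
`d̃(f, g) = max_σ d(f σ, g σ)`, i.e. with the metric of the space of continuous maps. Its group
structure is Mathlib's, given by composition. -/
noncomputable instance homeoCantorMetricSpace : MetricSpace (Cantor ≃ₜ Cantor) :=
  MetricSpace.induced (fun f : Cantor ≃ₜ Cantor => (f : C(Cantor, Cantor)))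
    (fun _ _ hfg => Homeomorph.ext fun σ => DFunLike.congr_fun hfg σ) inferInstance

theorem homeoCantor_dist_eq (f g : Cantor ≃ₜ Cantor) :
    dist f g = ⨆ σ : Cantor, dist (f σ) (g σ) :=
  ContinuousMap.dist_eq_iSup (f := (f : C(Cantor, Cantor))) (g := (g : C(Cantor, Cantor)))

/-- `x` is a recurrent point of `f` if it belongs to its own `ω`-limit set, i.e. if it is a limit
point of the sequence `f^n(x)`. -/
def IsRecurrentPoint {X : Type*} [TopologicalSpace X] (f : X → X) (x : X) : Prop :=
  x ∈ omegaLimit atTop (fun (n : ℕ) (y : X) => f^[n] y) {x}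

/-- `f` is chain continuous at `x`: for every `ε > 0` there is `δ > 0` such that every sequence
with `x₀ ∈ B(x; δ)` and `xₙ₊₁ ∈ B(f(xₙ); δ)` for all `n` satisfies `d(xₙ, f^n(x)) < ε`
for all `n`. -/
def ChainContinuousAt {X : Type*} [MetricSpace X] (f : X → X) (x : X) : Prop :=
  ∀ ε > 0, ∃ δ > 0, ∀ u : ℕ → X,
    u 0 ∈ Metric.ball x δ → (∀ n, u (n + 1) ∈ Metric.ball (f (u n)) δ) →
      ∀ n, dist (u n) (f^[n] x) < ε

/-! For every `ε`, a generic homeomorphism has a clopen partition into small cells whose transition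
graph is a disjoint union of dumbbells, occurring in pairs of twins that follow each other closely.
Having such a partition is an open condition, since it depends only on the cells of the images. It
is dense by a combinatorial construction (`Cantor.exists_twinDumbbells_near`), and for all `ε` at
once it is invariant under conjugacy. So every element of a comeager class has such partitions at
every scale.

In a dumbbell the only branching vertex is the exit `N - 1` of the left loop. Past it, each cell
determines the next one, so pseudo-orbits visit the same cells as true orbits: this gives chain
continuity. An orbit that never exits returns to its initial cell every `N` steps, so a nonrecurrent
point exits its dumbbell at a fine enough scale. The cell at `N` is never revisited, and its
iterates in both directions meet every cell, so the nonrecurrent points have dense interior.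

Equicontinuity fails at points that stay in a left loop but are limits of points that leave it. For
a fixed dumbbell these form a nonempty closed set. Twins at finer scales make it perfect, hence
uncountable. -/

/-! ### Clopen partitions of the Cantor space -/

theorem IsLocallyConstant.exists_eq_of_dist_lt {X Y : Type*} [PseudoMetricSpace X] [CompactSpace X]
    {f : X → Y} (hf : IsLocallyConstant f) :
    ∃ δ > 0, ∀ x y, dist x y < δ → f x = f y := by
  obtain ⟨δ, hδ, H⟩ := lebesgue_number_lemma_of_metric (s := (univ : Set X)) isCompact_univ
    (c := fun y => f ⁻¹' {y}) (fun y => hf.isOpen_fiber y) (fun x _ => mem_iUnion.2 ⟨f x, rfl⟩)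
  refine ⟨δ, hδ, fun x y hxy => ?_⟩
  obtain ⟨z, hz⟩ := H x (mem_univ x)
  have hx : f x = z := hz (Metric.mem_ball_self hδ)
  have hy : f y = z := hz (Metric.mem_ball'.2 hxy)
  rw [hx, hy]

theorem Cantor.exists_dist_lt_of_eq_on {ε : ℝ} (hε : 0 < ε) :
    ∃ n : ℕ, ∀ x y : Cantor, (∀ i < n, x i = y i) → dist x y < ε := by
  obtain ⟨n, hn⟩ := exists_nat_one_div_lt hε
  refine ⟨n + 1, fun x y hxy => lt_trans ?_ hn⟩
  exact (cantorDist_lt_iff x y n).2 fun i hi => hxy i (by omega)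

/-- Splitting a sequence into its first `n` terms and the remaining ones. -/
def Cantor.splitAt (n : ℕ) : Cantor ≃ₜ (Fin n → Bool) × Cantor where
  toFun x := (fun i => x i, fun k => x (n + k))
  invFun p := fun k => if h : k < n then p.1 ⟨k, h⟩ else p.2 (k - n)
  left_inv x := by
    funext k
    by_cases h : k < n
    · simp [h]
    · simp [h, Nat.add_sub_cancel' (not_lt.1 h)]
  right_inv p := by
    refine Prod.ext ?_ ?_
    · funext i
      simp
    · funext k
      simp
  continuous_toFun := by fun_prop
  continuous_invFun := by
    refine continuous_pi fun k => ?_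
    by_cases h : k < n
    · simp only [h, dite_true]
      fun_prop
    · simp only [h, dite_false]
      fun_prop

theorem Cantor.nonempty_homeomorph_fin_prod (n : ℕ) :
    Nonempty (Cantor ≃ₜ Fin (n + 1) × Cantor) := by
  induction n with
  | zero => exact ⟨(Homeomorph.uniqueProd (Fin 1) Cantor).symm⟩
  | succ n ih =>
    obtain ⟨e⟩ := ih
    have e2 : (Fin 1 → Bool) ≃ Fin 1 ⊕ Fin 1 := Fintype.equivOfCardEq (by simp)
    have e3 : Fin (n + 1 + 1) ≃ Fin (n + 1) ⊕ Fin 1 := finSumFinEquiv.symm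
    let u := (Homeomorph.uniqueProd (Fin 1) Cantor)
    let double : Cantor ≃ₜ Cantor ⊕ Cantor :=
      (Cantor.splitAt 1).trans ((e2.toHomeomorphOfDiscrete.prodCongr (.refl _)).trans
        (Homeomorph.sumProdDistrib.trans (u.sumCongr u)))
    exact ⟨double.trans ((e.sumCongr u.symm).trans
      (Homeomorph.sumProdDistrib.symm.trans (e3.symm.toHomeomorphOfDiscrete.prodCongr (.refl _))))⟩

theorem Cantor.nonempty_homeomorph_prod (F : Type*) [Finite F] [Nonempty F] [TopologicalSpace F]
    [DiscreteTopology F] : Nonempty (Cantor ≃ₜ F × Cantor) := by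
  obtain ⟨n, ⟨e⟩⟩ := Finite.exists_equiv_fin F
  cases n with
  | zero => exact (e (Classical.arbitrary F)).elim0
  | succ n =>
    obtain ⟨h⟩ := nonempty_homeomorph_fin_prod n
    exact ⟨h.trans (e.symm.toHomeomorphOfDiscrete.prodCongr (.refl _))⟩

/-- By compactness `α` depends on finitely many coordinates, so each fiber is a finite nonempty
union of cylinders, and such a union is again a Cantor space. -/
theorem Cantor.exists_homeomorph_fst_eq {E : Type*} [TopologicalSpace E]
    [DiscreteTopology E] {α : Cantor → E} (hα : IsLocallyConstant α)
    (hs : Function.Surjective α) : ∃ Φ : Cantor ≃ₜ E × Cantor, ∀ x, (Φ x).1 = α x := by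
  obtain ⟨δ, hδ, H⟩ := hα.exists_eq_of_dist_lt
  obtain ⟨n, hn⟩ := exists_dist_lt_of_eq_on hδ
  let a : (Fin n → Bool) → E := fun s => α ((splitAt n).symm (s, fun _ => false))
  have ha : ∀ x, a ((splitAt n x).1) = α x := fun x => H _ _ <| hn _ _ fun i hi => by
    simp [splitAt, hi]
  have hne : ∀ e, Nonempty {s // a s = e} := fun e => by
    obtain ⟨x, hx⟩ := hs e
    exact ⟨⟨_, (ha x).trans hx⟩⟩
  have k := fun e => (nonempty_homeomorph_prod {s // a s = e}).some
  let T : (Fin n → Bool) ≃ₜ Σ e, {s // a s = e} :=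
    (Equiv.sigmaFiberEquiv a).symm.toHomeomorphOfDiscrete
  let S : (Σ e, {s // a s = e} × Cantor) ≃ₜ E × Cantor :=
    { toFun := fun p => (p.1, (k p.1).symm p.2)
      invFun := fun p => ⟨p.1, k p.1 p.2⟩
      left_inv := fun p => by simp
      right_inv := fun p => by simp
      continuous_toFun := by
        refine continuous_sigma fun e => ?_
        exact continuous_const.prodMk (k e).symm.continuous
      continuous_invFun := by
        rw [continuous_prod_of_discrete_left]
        intro e
        exact continuous_sigmaMk.comp (k e).continuous }
  refine ⟨(splitAt n).trans ((T.prodCongr (.refl _)).trans (Homeomorph.sigmaProdDistrib.trans S)),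
    fun x => ?_⟩
  rw [← ha x]
  rfl

/-- A locally constant labelling can be refined along any surjection of label sets
with finite fibers. -/
theorem Cantor.exists_lift {E F : Type*} [Finite F] {α : Cantor → E}
    (hα : IsLocallyConstant α) (hs : Function.Surjective α) {ψ : F → E}
    (hψ : Function.Surjective ψ) :
    ∃ β : Cantor → F, IsLocallyConstant β ∧ Function.Surjective β ∧ ∀ x, ψ (β x) = α x := by
  let _ : TopologicalSpace E := ⊥
  have _ : DiscreteTopology E := ⟨rfl⟩
  let _ : TopologicalSpace F := ⊥
  have _ : DiscreteTopology F := ⟨rfl⟩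
  obtain ⟨Φ, hΦ⟩ := exists_homeomorph_fst_eq hα hs
  have hne : ∀ e, Nonempty {f // ψ f = e} := fun e => by
    obtain ⟨f, hf⟩ := hψ e
    exact ⟨⟨f, hf⟩⟩
  have k := fun e => (nonempty_homeomorph_prod {f // ψ f = e}).some
  let κ : E × Cantor → F := fun p => (k p.1 p.2).1
  have hc : Continuous κ := by
    rw [continuous_prod_of_discrete_left]
    intro e
    exact continuous_subtype_val.comp (continuous_fst.comp (k e).continuous)
  refine ⟨fun x => κ (Φ x), ?_, fun f => ?_, fun x => ?_⟩
  · rw [IsLocallyConstant.iff_continuous]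
    exact hc.comp Φ.continuous
  · refine ⟨Φ.symm (ψ f, (k (ψ f)).symm (⟨f, rfl⟩, fun _ => false)), ?_⟩
    simp [κ]
  · exact (k (Φ x).1 (Φ x).2).1.2.trans (hΦ x)

theorem Cantor.exists_homeomorph_comp_eq {E : Type*} {α β : Cantor → E}
    (hα : IsLocallyConstant α) (hα' : Function.Surjective α)
    (hβ : IsLocallyConstant β) (hβ' : Function.Surjective β) :
    ∃ g : Cantor ≃ₜ Cantor, ∀ x, β (g x) = α x := by
  let _ : TopologicalSpace E := ⊥
  have _ : DiscreteTopology E := ⟨rfl⟩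
  obtain ⟨Φ, hΦ⟩ := exists_homeomorph_fst_eq hα hα'
  obtain ⟨Ψ, hΨ⟩ := exists_homeomorph_fst_eq hβ hβ'
  refine ⟨Φ.trans Ψ.symm, fun x => ?_⟩
  rw [← hΨ, ← hΦ]
  simp

/-- Prescribes the transition graph of a perturbation of `h`. Points are labelled by edges `a` lying
over the transitions of `h`, and their sources give the new partition `v`. A second edge labelling
`b` has `v` as its target, and `g` carries the `a`-cells onto the `b`-cells: `x` traverses the edge
`a x` and arrives at its target. -/
theorem Cantor.exists_homeomorph_of_graph {ι V E : Type*} [Finite E] (h : Cantor ≃ₜ Cantor)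
    {c : Cantor → ι} (hc : IsLocallyConstant c) {src tgt : E → V}
    (hsrc : Function.Surjective src) (htgt : Function.Surjective tgt) (φ : V → ι)
    (hφ : ∀ e, ∃ x, c x = φ (src e) ∧ c (h x) = φ (tgt e))
    (hφ' : ∀ x, ∃ e, φ (src e) = c x ∧ φ (tgt e) = c (h x)) :
    ∃ (g : Cantor ≃ₜ Cantor) (v : Cantor → V), IsLocallyConstant v ∧ Function.Surjective v ∧
      (∀ x, φ (v x) = c x) ∧ (∀ x, c (g x) = c (h x)) ∧
      ∀ x, ∃ e, src e = v x ∧ tgt e = v (g x) := by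
  have hlc : IsLocallyConstant fun x => (c x, c (h x)) :=
    hc.prodMk (hc.comp_continuous h.continuous)
  let α : Cantor → range fun x => (c x, c (h x)) := rangeFactorization _
  have hα : IsLocallyConstant α :=
    IsLocallyConstant.desc α Subtype.val hlc Subtype.val_injective
  let ψ : E → range fun x => (c x, c (h x)) := fun e =>
    ⟨(φ (src e), φ (tgt e)), by
      obtain ⟨x, h1, h2⟩ := hφ e
      exact ⟨x, Prod.ext h1 h2⟩⟩
  have hψ : Function.Surjective ψ := by
    rintro ⟨_, x, rfl⟩
    obtain ⟨e, h1, h2⟩ := hφ' x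
    exact ⟨e, Subtype.ext (Prod.ext h1 h2)⟩
  obtain ⟨a, ha, ha', hψa⟩ := exists_lift hα rangeFactorization_surjective hψ
  have hψa1 : ∀ x, φ (src (a x)) = c x := fun x => congrArg (fun p => p.1.1) (hψa x)
  have hψa2 : ∀ x, φ (tgt (a x)) = c (h x) := fun x => congrArg (fun p => p.1.2) (hψa x)
  have hv : IsLocallyConstant fun x => src (a x) := ha.comp src
  have hv' : Function.Surjective fun x => src (a x) := hsrc.comp ha'
  obtain ⟨b, hb, hb', hsb⟩ := exists_lift hv hv' htgt
  obtain ⟨g, hg⟩ := exists_homeomorph_comp_eq ha ha' hb hb'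
  refine ⟨g, fun x => src (a x), hv, hv', hψa1, fun x => ?_, fun x => ⟨a x, rfl, ?_⟩⟩
  · rw [← hψa1, ← hsb, hg, hψa2]
  · exact (congrArg tgt (hg x)).symm.trans (hsb (g x))

/-! ### Dumbbell graphs and their density -/

theorem exists_iterate_two_mul_eq {ι : Type*} [Finite ι] (f p : ι → ι) :
    ∃ N > 0, f^[2 * N] = f^[N] ∧ p^[2 * N] = p^[N] := by
  obtain ⟨i, j, hij, heq⟩ := Finite.exists_ne_map_eq_of_infinite fun n : ℕ => (f^[n], p^[n])
  wlog hlt : i < j generalizing i j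
  · exact this j i hij.symm heq.symm (by omega)
  obtain ⟨q, rfl⟩ := Nat.exists_eq_add_of_le hlt.le
  have hq : 0 < q := by omega
  have key : ∀ u : ι → ι, u^[i] = u^[i + q] → u^[2 * ((i + 1) * q)] = u^[(i + 1) * q] := by
    intro u hu
    have step : ∀ m, i ≤ m → ∀ k, u^[m + k * q] = u^[m] := by
      intro m hm k
      induction k with
      | zero => simp
      | succ k ih =>
        rw [← ih]
        obtain ⟨r, hr⟩ := Nat.exists_eq_add_of_le (hm.trans (Nat.le_add_right m (k * q)))
        have : m + (k + 1) * q = r + (i + q) := by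
          rw [Nat.succ_mul]
          omega
        rw [this, hr, Function.iterate_add, ← hu, ← Function.iterate_add, Nat.add_comm]
    rw [two_mul]
    exact step _ (by nlinarith) _
  -- A multiple of the common period `q` that is at least the preperiod `i`.
  exact ⟨(i + 1) * q, by positivity, key f (congrArg Prod.fst heq), key p (congrArg Prod.snd heq)⟩

/-- The edges of a dumbbell with vertices `0, …, 4 * N - 1`: a left loop on the vertices `i < N`,
a right loop on the vertices `3 * N ≤ i`, and the path through all vertices. -/
def DumbbellEdge (N i k : ℕ) : Prop :=
  (i + 1 = k ∧ k < 4 * N) ∨ (i + 1 = N ∧ k = 0) ∨ (i + 1 = 4 * N ∧ k = 3 * N)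

/-- A clopen partition of `X` whose graph under `g` is a disjoint union of dumbbells. The dumbbells
are indexed by `J × Bool`, and the corresponding cells of the twins `(j, false)` and `(j, true)`
are together contained in a set of small diameter. -/
structure TwinDumbbells {X : Type*} [MetricSpace X] (g : X → X) (ε : ℝ) (J : Type*) where
  N : ℕ
  N_pos : 0 < N
  comp : X → J × Bool
  comp_locallyConstant : IsLocallyConstant comp
  pos : X → ℕ
  pos_locallyConstant : IsLocallyConstant pos
  comp_apply : ∀ x, comp (g x) = comp x
  edge : ∀ x, DumbbellEdge N (pos x) (pos (g x))
  exists_pos_eq : ∀ q, ∃ x, comp x = q ∧ pos x = N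
  dist_lt : ∀ x y, (comp x).1 = (comp y).1 → pos x = pos y → dist x y < ε

/-- Iterate a choice `f` of successors from `b` and a choice `p` of predecessors from `a`. Both
become periodic, and `p^[2 * N] = p^[N]`, `f^[2 * N] = f^[N]` close the left and right loops of the
dumbbell with the edge from `a` to `b` at its middle. -/
theorem exists_walk {ι : Type*} [Finite ι] (R : ι → ι → Prop) (hout : ∀ a, ∃ b, R a b)
    (hin : ∀ b, ∃ a, R a b) :
    ∃ N > 0, ∀ a b, R a b → ∃ w : ℕ → ι, w (2 * N - 1) = a ∧ w (2 * N) = b ∧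
      ∀ i k, DumbbellEdge N i k → R (w i) (w k) := by
  choose f hf using hout
  choose p hp using hin
  obtain ⟨N, hN, hfN, hpN⟩ := exists_iterate_two_mul_eq f p
  refine ⟨N, hN, fun a b hab =>
    ⟨fun i => if i < 2 * N then p^[2 * N - 1 - i] a else f^[i - 2 * N] b, ?_, ?_, ?_⟩⟩
  · simp [hN]
  · simp
  · rintro i k (⟨rfl, hk⟩ | ⟨hi, rfl⟩ | ⟨hi, rfl⟩)
    · rcases lt_trichotomy (i + 1) (2 * N) with hlt | heq | hgt
      · simp only [hlt, if_true, show i < 2 * N by omega]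
        rw [show 2 * N - 1 - i = 2 * N - 1 - (i + 1) + 1 by omega, Function.iterate_succ_apply']
        exact hp _
      · simp only [heq, lt_irrefl, if_false, show i < 2 * N by omega, if_true,
          show 2 * N - 1 - i = 0 by omega, Nat.sub_self]
        exact hab
      · simp only [show ¬ i + 1 < 2 * N by omega, show ¬ i < 2 * N by omega, if_false]
        rw [show i + 1 - 2 * N = i - 2 * N + 1 by omega, Function.iterate_succ_apply']
        exact hf _
    · simp only [show i < 2 * N by omega, show 0 < 2 * N by omega, if_true]
      rw [show 2 * N - 1 - i = N by omega, ← hpN, show 2 * N = 2 * N - 1 - 0 + 1 by omega,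
        Function.iterate_succ_apply', Nat.add_sub_cancel]
      exact hp _
    · simp only [show ¬ i < 2 * N by omega, show ¬ 3 * N < 2 * N by omega, if_false]
      rw [show 3 * N - 2 * N = N by omega, ← hfN, show 2 * N = (i - 2 * N) + 1 by omega,
        Function.iterate_succ_apply']
      convert hf _ using 3
      omega

theorem DumbbellEdge.left_lt {N i k : ℕ} (h : DumbbellEdge N i k) : i < 4 * N := by
  unfold DumbbellEdge at h
  omega

theorem Cantor.exists_twinDumbbells_near (h : Cantor ≃ₜ Cantor) {ε : ℝ} (hε : 0 < ε) :
    ∃ (g : Cantor ≃ₜ Cantor) (J : Type), (∀ x, dist (g x) (h x) < ε) ∧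
      Nonempty (TwinDumbbells g ε J) := by
  obtain ⟨n, hn⟩ := exists_dist_lt_of_eq_on hε
  let c : Cantor → Fin n → Bool := fun x i => x i
  have hcs : Function.Surjective c := fun s =>
    ⟨(splitAt n).symm (s, fun _ => false), by funext i; simp [c, splitAt]⟩
  have hc : IsLocallyConstant c := by
    rw [IsLocallyConstant.iff_continuous]
    fun_prop
  have hdist : ∀ x y, c x = c y → dist x y < ε := fun x y hxy =>
    hn x y fun i hi => congrFun hxy ⟨i, hi⟩
  let R : (Fin n → Bool) → (Fin n → Bool) → Prop := fun a b => ∃ x, c x = a ∧ c (h x) = b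
  obtain ⟨N, hN, hw⟩ := exists_walk R
    (fun a => (hcs a).imp' (fun x => c (h x)) fun x hx => ⟨x, hx, rfl⟩)
    (fun b => (h.surjective.exists.1 (hcs b)).imp' c fun x hx => ⟨x, rfl, hx⟩)
  -- One pair of twins for each transition of `h`, so that the middle edges already cover all
  -- transitions. Twins map to the same walk, which keeps them close.
  let J := {e : (Fin n → Bool) × (Fin n → Bool) // R e.1 e.2}
  choose w hw1 hw2 hw3 using fun e : J => hw e.1.1 e.1.2 e.2
  let V := (J × Bool) × Fin (4 * N)
  let E := (J × Bool) × {p : Fin (4 * N) × Fin (4 * N) // DumbbellEdge N p.1 p.2}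
  let src : E → V := fun e => (e.1, e.2.1.1)
  let tgt : E → V := fun e => (e.1, e.2.1.2)
  let φ : V → Fin n → Bool := fun v => w v.1.1 v.2
  obtain ⟨g, v, hv, hvs, hφv, hg, hedge⟩ := exists_homeomorph_of_graph h hc (E := E) (src := src)
    (tgt := tgt) (by
      rintro ⟨q, i, hi⟩
      by_cases hi' : i + 1 < 4 * N
      · exact ⟨(q, ⟨(⟨i, hi⟩, ⟨i + 1, hi'⟩), Or.inl ⟨rfl, hi'⟩⟩), rfl⟩
      · exact ⟨(q, ⟨(⟨i, hi⟩, ⟨3 * N, by omega⟩), Or.inr (Or.inr ⟨by simp; omega, rfl⟩)⟩), rfl⟩)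
    (by
      rintro ⟨q, i, hi⟩
      cases i with
      | zero =>
        exact ⟨(q, ⟨(⟨N - 1, by omega⟩, ⟨0, hi⟩), Or.inr (Or.inl ⟨by simp; omega, rfl⟩)⟩), rfl⟩
      | succ i => exact ⟨(q, ⟨(⟨i, by omega⟩, ⟨i + 1, hi⟩), Or.inl ⟨rfl, hi⟩⟩), rfl⟩)
    φ (fun e => hw3 e.1.1 _ _ e.2.2)
    (fun x => ⟨((⟨(c x, c (h x)), x, rfl, rfl⟩, false),
      ⟨(⟨2 * N - 1, by omega⟩, ⟨2 * N, by omega⟩), Or.inl ⟨by simp; omega, by simp; omega⟩⟩),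
      hw1 _, hw2 _⟩)
  have hedge' : ∀ x, (v (g x)).1 = (v x).1 ∧ DumbbellEdge N (v x).2 (v (g x)).2 := by
    intro x
    obtain ⟨e, h1, h2⟩ := hedge x
    rw [← h1, ← h2]
    exact ⟨rfl, e.2.2⟩
  exact ⟨g, J, fun x => hdist _ _ (hg x), ⟨
    { N := N
      N_pos := hN
      comp := fun x => (v x).1
      comp_locallyConstant := hv.comp Prod.fst
      pos := fun x => (v x).2
      pos_locallyConstant := hv.comp fun p => (p.2 : ℕ)
      comp_apply := fun x => (hedge' x).1
      edge := fun x => (hedge' x).2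
      exists_pos_eq := fun q => by
        obtain ⟨x, hx⟩ := hvs (q, ⟨N, by omega⟩)
        exact ⟨x, by rw [hx], by rw [hx]⟩
      dist_lt := fun x y h1 h2 => by
        apply hdist
        rw [← hφv, ← hφv]
        change w (v x).1.1 (v x).2 = w (v y).1.1 (v y).2
        rw [h1, h2] }⟩⟩

namespace TwinDumbbells

variable {X : Type*} [MetricSpace X] {g : X → X} {ε : ℝ} {J : Type*}

/-- The cell of a point, as a pair of its dumbbell and its vertex. -/
def cell (T : TwinDumbbells g ε J) (x : X) : (J × Bool) × ℕ := (T.comp x, T.pos x)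

theorem cell_locallyConstant (T : TwinDumbbells g ε J) : IsLocallyConstant T.cell :=
  T.comp_locallyConstant.prodMk T.pos_locallyConstant

/-- Dumbbell partitions depend on the map only through the cells of the images. -/
def congr (T : TwinDumbbells g ε J) {f : X → X} (h : ∀ x, T.cell (f x) = T.cell (g x)) :
    TwinDumbbells f ε J :=
  { T with
    comp_apply := fun x => (congrArg Prod.fst (h x)).trans (T.comp_apply x)
    edge := fun x => by
      have : T.pos (f x) = T.pos (g x) := congrArg Prod.snd (h x)
      rw [this]
      exact T.edge x }

def mono (T : TwinDumbbells g ε J) {ε' : ℝ} (h : ε ≤ ε') : TwinDumbbells g ε' J :=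
  { T with dist_lt := fun x y h1 h2 => (T.dist_lt x y h1 h2).trans_le h }

def conj (T : TwinDumbbells g ε J) (k : X ≃ₜ X) {ε' : ℝ}
    (hk : ∀ x y, dist x y < ε → dist (k x) (k y) < ε') :
    TwinDumbbells (fun x => k (g (k.symm x))) ε' J where
  N := T.N
  N_pos := T.N_pos
  comp := fun x => T.comp (k.symm x)
  comp_locallyConstant := T.comp_locallyConstant.comp_continuous k.symm.continuous
  pos := fun x => T.pos (k.symm x)
  pos_locallyConstant := T.pos_locallyConstant.comp_continuous k.symm.continuous
  comp_apply := fun x => by simp [T.comp_apply]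
  edge := fun x => by simpa using T.edge (k.symm x)
  exists_pos_eq := fun q => by
    obtain ⟨x, h1, h2⟩ := T.exists_pos_eq q
    exact ⟨k x, by simpa using h1, by simpa using h2⟩
  dist_lt := fun x y h1 h2 => by simpa using hk _ _ (T.dist_lt _ _ h1 h2)

end TwinDumbbells

/-! ### Genericity in the homeomorphism group -/

/-- The given metric need not be complete; recording the inverse as well identifies the group with
the closed set of pairs of mutually inverse maps, which yields the Baire property. -/
theorem homeoCantor_isClosedEmbedding :
    IsClosedEmbedding fun h : Cantor ≃ₜ Cantor =>
      ((h : C(Cantor, Cantor)), (h.symm : C(Cantor, Cantor))) := by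
  have hind : IsInducing fun h : Cantor ≃ₜ Cantor => (h : C(Cantor, Cantor)) := ⟨rfl⟩
  have hsymm : Continuous fun h : Cantor ≃ₜ Cantor => (h.symm : C(Cantor, Cantor)) := by
    rw [Metric.continuous_iff]
    intro h ε hε
    obtain ⟨δ, hδ, H⟩ := Metric.uniformContinuous_iff.1
      (CompactSpace.uniformContinuous_of_continuous h.symm.continuous) ε hε
    refine ⟨δ, hδ, fun f hf => ?_⟩
    rw [ContinuousMap.dist_lt_iff hε]
    intro x
    have hx : dist (f (f.symm x)) (h (f.symm x)) < δ :=
      (ContinuousMap.dist_apply_le_dist (f := (f : C(Cantor, Cantor)))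
        (g := (h : C(Cantor, Cantor))) (f.symm x)).trans_lt hf
    have := H hx
    rw [dist_comm] at this
    simpa using this
  have hcont : Continuous fun h : Cantor ≃ₜ Cantor =>
      ((h : C(Cantor, Cantor)), (h.symm : C(Cantor, Cantor))) := hind.continuous.prodMk hsymm
  refine ⟨⟨IsInducing.of_comp hcont continuous_fst hind, fun f h hfh =>
    Homeomorph.ext fun x => DFunLike.congr_fun (congrArg Prod.fst hfh) x⟩, ?_⟩
  have : range (fun h : Cantor ≃ₜ Cantor =>
      ((h : C(Cantor, Cantor)), (h.symm : C(Cantor, Cantor)))) =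
      {p : C(Cantor, Cantor) × C(Cantor, Cantor) |
        p.1.comp p.2 = ContinuousMap.id _ ∧ p.2.comp p.1 = ContinuousMap.id _} := by
    ext ⟨a, b⟩
    constructor
    · rintro ⟨h, hh⟩
      cases hh
      constructor <;> ext x <;> simp
    · rintro ⟨h1, h2⟩
      exact ⟨{ toFun := a
               invFun := b
               left_inv := fun x => DFunLike.congr_fun h2 x
               right_inv := fun x => DFunLike.congr_fun h1 x }, rfl⟩
  rw [this]
  refine IsClosed.inter (isClosed_eq ?_ continuous_const) (isClosed_eq ?_ continuous_const)
  · exact ContinuousMap.continuous_comp'.comp continuous_swap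
  · exact ContinuousMap.continuous_comp'

theorem homeoCantor_baireSpace : BaireSpace (Cantor ≃ₜ Cantor) :=
  have := homeoCantor_isClosedEmbedding.IsCompletelyMetrizableSpace
  inferInstance

theorem homeoCantor_dist_apply_le (f g : Cantor ≃ₜ Cantor) (x : Cantor) :
    dist (f x) (g x) ≤ dist f g :=
  ContinuousMap.dist_apply_le_dist (f := (f : C(Cantor, Cantor))) (g := (g : C(Cantor, Cantor))) x

theorem homeoCantor_dist_lt {f g : Cantor ≃ₜ Cantor} {ε : ℝ} (hε : 0 < ε)
    (h : ∀ x, dist (f x) (g x) < ε) : dist f g < ε :=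
  (ContinuousMap.dist_lt_iff hε (f := (f : C(Cantor, Cantor))) (g := (g : C(Cantor, Cantor)))).2 h

theorem isOpen_setOf_twinDumbbells (ε : ℝ) :
    IsOpen {g : Cantor ≃ₜ Cantor | ∃ J : Type, Nonempty (TwinDumbbells g ε J)} := by
  rw [Metric.isOpen_iff]
  rintro g ⟨J, ⟨T⟩⟩
  obtain ⟨δ, hδ, H⟩ := T.cell_locallyConstant.exists_eq_of_dist_lt
  exact ⟨δ, hδ, fun f hf =>
    ⟨J, ⟨T.congr fun x => H _ _ ((homeoCantor_dist_apply_le f g x).trans_lt hf)⟩⟩⟩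

theorem dense_setOf_twinDumbbells {ε : ℝ} (hε : 0 < ε) :
    Dense {g : Cantor ≃ₜ Cantor | ∃ J : Type, Nonempty (TwinDumbbells g ε J)} := by
  rw [Metric.dense_iff]
  intro h r hr
  obtain ⟨g, J, hg, ⟨T⟩⟩ := Cantor.exists_twinDumbbells_near h (lt_min hε hr)
  exact ⟨g, homeoCantor_dist_lt hr fun x => (hg x).trans_le (min_le_right _ _),
    J, ⟨T.mono (min_le_left _ _)⟩⟩

/-- The class meets the residual set of maps with partitions at every scale; a conjugating
homeomorphism is uniformly continuous, so it transports fine partitions to fine partitions. -/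
theorem exists_twinDumbbells_of_residual {C : ConjClasses (Cantor ≃ₜ Cantor)}
    (hC : C.carrier ∈ residual (Cantor ≃ₜ Cantor)) {h : Cantor ≃ₜ Cantor} (hh : h ∈ C.carrier)
    {ε : ℝ} (hε : 0 < ε) : ∃ J : Type, Nonempty (TwinDumbbells h ε J) := by
  have := homeoCantor_baireSpace
  have hres : ∀ᶠ g : Cantor ≃ₜ Cantor in residual _, ∀ n : ℕ,
      ∃ J : Type, Nonempty (TwinDumbbells g (1 / ((n : ℝ) + 1)) J) :=
    eventually_countable_forall.2 fun n => residual_of_dense_open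
      (isOpen_setOf_twinDumbbells _) (dense_setOf_twinDumbbells (by positivity))
  obtain ⟨g, hgC, hg⟩ := (dense_of_mem_residual (inter_mem hC hres)).nonempty
  obtain ⟨k, rfl⟩ := isConj_iff.1 (ConjClasses.mk_eq_mk_iff_isConj.1
    ((ConjClasses.mem_carrier_iff_mk_eq.1 hgC).trans (ConjClasses.mem_carrier_iff_mk_eq.1 hh).symm))
  obtain ⟨δ, hδ, H⟩ := Metric.uniformContinuous_iff.1
    (CompactSpace.uniformContinuous_of_continuous k.continuous) ε hε
  obtain ⟨n, hn⟩ := exists_nat_one_div_lt hδ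
  obtain ⟨J, ⟨T⟩⟩ := hg n
  exact ⟨J, ⟨T.conj k fun x y hxy => H (hxy.trans hn)⟩⟩

/-! ### Recurrence and shadowing -/

theorem isRecurrentPoint_iff {X : Type*} [TopologicalSpace X] {f : X → X} {x : X} :
    IsRecurrentPoint f x ↔ ∀ U ∈ 𝓝 x, ∃ᶠ n in atTop, f^[n] x ∈ U := by
  simp only [IsRecurrentPoint, mem_omegaLimit_iff_frequently, singleton_inter_nonempty,
    mem_preimage]

theorem Homeomorph.isRecurrentPoint_apply_iff {X : Type*} [TopologicalSpace X] (g : X ≃ₜ X)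
    {x : X} : IsRecurrentPoint g (g x) ↔ IsRecurrentPoint g x := by
  simp only [isRecurrentPoint_iff, ← Function.iterate_succ_apply, Function.iterate_succ_apply']
  constructor
  · intro h U hU
    refine (h (g '' U) (g.isOpenMap.image_mem_nhds hU)).mono fun n hn => ?_
    exact (g.injective.mem_set_image).1 hn
  · intro h U hU
    exact h (g ⁻¹' U) (g.continuous.continuousAt hU)

theorem Homeomorph.apply_mem_interior_not_isRecurrentPoint_iff {X : Type*} [TopologicalSpace X]
    (g : X ≃ₜ X) {x : X} :
    g x ∈ interior {y | ¬ IsRecurrentPoint g y} ↔ x ∈ interior {y | ¬ IsRecurrentPoint g y} := by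
  rw [← mem_preimage, g.preimage_interior]
  simp only [preimage_ofPred_eq, g.isRecurrentPoint_apply_iff]

/-- Pseudo-orbits starting close to `x` stay `ε`-close to the orbit of `x`. -/
def ShadowsWithin {X : Type*} [MetricSpace X] (f : X → X) (ε : ℝ) (x : X) : Prop :=
  ∃ δ > 0, ∀ u : ℕ → X, u 0 ∈ Metric.ball x δ →
    (∀ n, u (n + 1) ∈ Metric.ball (f (u n)) δ) → ∀ n, dist (u n) (f^[n] x) < ε

namespace ShadowsWithin

variable {X : Type*} [MetricSpace X] {f : X → X} {ε : ℝ} {x : X}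

theorem of_apply (hf : Continuous f) (hε : 0 < ε) (h : ShadowsWithin f ε (f x)) :
    ShadowsWithin f ε x := by
  obtain ⟨δ, hδ, H⟩ := h
  obtain ⟨η, hη, Hη⟩ := Metric.continuous_iff.1 hf x (δ / 2) (half_pos hδ)
  refine ⟨min ε (min η (δ / 2)), by positivity, fun u h0 hu n => ?_⟩
  simp only [Metric.mem_ball, lt_min_iff] at h0 hu
  cases n with
  | zero => exact h0.1
  | succ n =>
    refine H (fun m => u (m + 1)) ?_ (fun m => ?_) n
    · have h1 := Hη _ h0.2.1
      have h2 := (hu 0).2.2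
      have h3 := dist_triangle (u 1) (f (u 0)) (f x)
      rw [Metric.mem_ball]
      simp only [zero_add] at h2 ⊢
      linarith
    · have := (hu (m + 1)).2.2
      rw [Metric.mem_ball]
      linarith

theorem of_iterate (hf : Continuous f) (hε : 0 < ε) (m : ℕ) (h : ShadowsWithin f ε (f^[m] x)) :
    ShadowsWithin f ε x := by
  induction m generalizing x with
  | zero => exact h
  | succ m ih => exact of_apply hf hε (ih h)

theorem eventually_dist_lt (h : ShadowsWithin f ε x) :
    ∀ᶠ y in 𝓝 x, ∀ n, dist (f^[n] y) (f^[n] x) < ε := by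
  obtain ⟨δ, hδ, H⟩ := h
  filter_upwards [Metric.ball_mem_nhds x hδ] with y hy
  exact H (fun n => f^[n] y) hy fun n => by
    rw [Function.iterate_succ_apply']
    exact Metric.mem_ball_self hδ

end ShadowsWithin

/-! ### Dynamics in a dumbbell partition -/

namespace TwinDumbbells

section Map

variable {X : Type*} [MetricSpace X] {g : X → X} {ε : ℝ} {J : Type*} (T : TwinDumbbells g ε J)
  {x y : X}

theorem dist_lt_of_cell_eq (h : T.cell x = T.cell y) : dist x y < ε :=
  T.dist_lt _ _ (congrArg (fun p => p.1.1) h) (congrArg Prod.snd h)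

theorem pos_lt (x : X) : T.pos x < 4 * T.N := (T.edge x).left_lt

theorem comp_iterate (n : ℕ) (x : X) : T.comp (g^[n] x) = T.comp x := by
  induction n with
  | zero => rfl
  | succ n ih => rw [Function.iterate_succ_apply', T.comp_apply, ih]

theorem le_pos_apply (h : T.N ≤ T.pos x) : T.N ≤ T.pos (g x) := by
  have := T.edge x
  unfold DumbbellEdge at this
  omega

theorem lt_pos_apply (h : T.N ≤ T.pos x) : T.N < T.pos (g x) := by
  have := T.N_pos
  have h1 := T.edge x
  unfold DumbbellEdge at h1
  omega

theorem cell_apply_eq (h : T.N ≤ T.pos x) (hxy : T.cell y = T.cell x) :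
    T.cell (g y) = T.cell (g x) := by
  have h1 := T.edge x
  have h2 := T.edge y
  have h3 : T.comp y = T.comp x := congrArg Prod.fst hxy
  have h4 : T.pos y = T.pos x := congrArg Prod.snd hxy
  refine Prod.ext (by simp only [cell, T.comp_apply, h3]) ?_
  change T.pos (g y) = T.pos (g x)
  unfold DumbbellEdge at h1 h2
  omega

theorem le_pos_iterate (h : T.N ≤ T.pos x) (n : ℕ) : T.N ≤ T.pos (g^[n] x) := by
  induction n with
  | zero => exact h
  | succ n ih =>
    rw [Function.iterate_succ_apply']
    exact T.le_pos_apply ih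

theorem pos_iterate_of_pos_eq (h : T.pos x = T.N) {n : ℕ} (hn : T.N + n < 4 * T.N) :
    T.pos (g^[n] x) = T.N + n := by
  induction n with
  | zero => exact h
  | succ n ih =>
    have h1 := ih (by omega)
    have h2 := T.edge (g^[n] x)
    rw [Function.iterate_succ_apply']
    unfold DumbbellEdge at h2
    omega

theorem pos_iterate_of_forall_lt (h : ∀ n, T.pos (g^[n] x) < T.N) (n : ℕ) :
    T.pos (g^[n] x) = (T.pos x + n) % T.N := by
  induction n with
  | zero => exact (Nat.mod_eq_of_lt (h 0)).symm
  | succ n ih =>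
    have h1 := T.edge (g^[n] x)
    have h2 := h (n + 1)
    have h3 := h n
    rw [← Nat.add_assoc, Nat.add_mod, ← ih]
    rw [Function.iterate_succ_apply'] at h2 ⊢
    rcases h1 with ⟨h1, -⟩ | ⟨h1, h4⟩ | ⟨h1, -⟩
    · rw [← h1, Nat.add_mod_mod, Nat.mod_eq_of_lt (by omega)]
    · rw [h4, Nat.add_mod_mod, h1, Nat.mod_self]
    · omega

theorem exists_pos_iterate_eq (h : ∀ n, T.pos (g^[n] x) < T.N) {i : ℕ} (hi : i < T.N) :
    ∃ n, T.pos (g^[n] x) = i := by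
  refine ⟨T.N - T.pos x + i, ?_⟩
  have h0 : T.pos x < T.N := h 0
  rw [T.pos_iterate_of_forall_lt h, ← Nat.add_assoc, Nat.add_sub_cancel' h0.le,
    Nat.add_mod_left, Nat.mod_eq_of_lt hi]

/-- Jumps too small to change cells cannot separate a pseudo-orbit from the orbit once the next cell
is determined by the current one. The first `m` steps are absorbed by continuity. -/
theorem shadowsWithin [CompactSpace X] (hg : Continuous g) (hε : 0 < ε) {m : ℕ}
    (h : T.N ≤ T.pos (g^[m] x)) : ShadowsWithin g ε x := by
  refine ShadowsWithin.of_iterate hg hε m ?_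
  obtain ⟨δ, hδ, H⟩ := T.cell_locallyConstant.exists_eq_of_dist_lt
  refine ⟨δ, hδ, fun u h0 hu n => T.dist_lt_of_cell_eq ?_⟩
  induction n with
  | zero => exact H _ _ h0
  | succ n ih =>
    rw [H _ _ (hu n), Function.iterate_succ_apply']
    exact T.cell_apply_eq (T.le_pos_iterate h n) ih

theorem exists_le_pos_of_dist_le [CompactSpace X] {M : ℕ} (h : ∀ n ≥ M, ε ≤ dist (g^[n] x) x) :
    ∃ m, T.N ≤ T.pos (g^[m] x) := by
  by_contra! hlt
  -- A multiple of the loop length beyond `M`: at that time the orbit is back in its initial cell.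
  have hM : M ≤ T.N * M := Nat.le_mul_of_pos_left M T.N_pos
  refine (h _ hM).not_gt (T.dist_lt_of_cell_eq (Prod.ext (T.comp_iterate _ _) ?_))
  change T.pos _ = T.pos _
  rw [T.pos_iterate_of_forall_lt hlt, Nat.add_mul_mod_self_left, Nat.mod_eq_of_lt (a := T.pos x) (hlt 0)]

theorem not_isRecurrentPoint_of_pos_eq (h : T.pos x = T.N) : ¬ IsRecurrentPoint g x := by
  rw [isRecurrentPoint_iff]
  intro hrec
  have hU : {y | T.pos y = T.N} ∈ 𝓝 x := (T.pos_locallyConstant.isOpen_fiber _).mem_nhds h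
  obtain ⟨n, hn, hn'⟩ := ((hrec _ hU).and_eventually (eventually_ge_atTop 1)).exists
  obtain ⟨k, rfl⟩ := Nat.exists_eq_add_of_le' hn'
  rw [mem_ofPred_eq, Function.iterate_succ_apply'] at hn
  exact (T.lt_pos_apply (T.le_pos_iterate h.ge k)).ne' hn

end Map

section Homeo

variable {X : Type*} [MetricSpace X] {g : X ≃ₜ X} {ε : ℝ} {J : Type*} (T : TwinDumbbells g ε J)
  {x y : X}

theorem comp_symm_apply (x : X) : T.comp (g.symm x) = T.comp x := by
  rw [← T.comp_apply, g.apply_symm_apply]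

theorem comp_symm_iterate (n : ℕ) (x : X) : T.comp (g.symm^[n] x) = T.comp x := by
  induction n with
  | zero => rfl
  | succ n ih => rw [Function.iterate_succ_apply', T.comp_symm_apply, ih]

theorem edge_symm (x : X) : DumbbellEdge T.N (T.pos (g.symm x)) (T.pos x) := by
  have := T.edge (g.symm x)
  rwa [g.apply_symm_apply] at this

theorem pos_symm_iterate {i j : ℕ} (h : T.pos x = i + j) (hi : i + j ≤ T.N) :
    T.pos (g.symm^[j] x) = i := by
  have := T.N_pos
  induction j generalizing x with
  | zero => exact h
  | succ j ih =>
    have h1 := T.edge_symm x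
    rw [Function.iterate_succ_apply]
    unfold DumbbellEdge at h1
    exact ih (by omega) (by omega)

theorem pos_symm_iterate_N (h : T.pos x < T.N) : T.pos (g.symm^[T.N] x) = T.pos x := by
  obtain ⟨j, hj⟩ := Nat.exists_eq_add_of_lt h
  have h1 : T.pos (g.symm^[T.pos x] x) = 0 := T.pos_symm_iterate (by omega) (by omega)
  have h2 := T.edge_symm (g.symm^[T.pos x] x)
  rw [← Function.iterate_succ_apply' g.symm, Nat.succ_eq_add_one] at h2
  have h3 : T.pos (g.symm^[T.pos x + 1] x) = T.pos x + j := by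
    unfold DumbbellEdge at h2
    omega
  have h4 := T.pos_symm_iterate h3 (by omega)
  rwa [← Function.iterate_add_apply, show j + (T.pos x + 1) = T.N by omega] at h4

theorem pos_symm_iterate_add_mul {i : ℕ} (hi : i < T.N) (h : T.pos x = T.N) (k : ℕ) :
    T.pos (g.symm^[T.N - i + k * T.N] x) = i := by
  induction k with
  | zero =>
    rw [Nat.zero_mul, Nat.add_zero]
    exact T.pos_symm_iterate (by omega) (by omega)
  | succ k ih =>
    rw [Nat.succ_mul, ← Nat.add_assoc, Nat.add_comm, Function.iterate_add_apply,
      T.pos_symm_iterate_N (by omega), ih]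

theorem pos_symm_iterate_lt (h : T.pos x = T.N) {n : ℕ} (hn : 0 < n) :
    T.pos (g.symm^[n] x) < T.N := by
  have := T.N_pos
  induction n, hn using Nat.le_induction with
  | base =>
    have h1 := T.edge_symm x
    unfold DumbbellEdge at h1
    rw [Function.iterate_one]
    omega
  | succ n _ ih =>
    have h1 := T.edge_symm (g.symm^[n] x)
    rw [Function.iterate_succ_apply']
    unfold DumbbellEdge at h1
    omega

/-- The cell at position `N` is open and consists of nonrecurrent points. Forward iterates reach the
later positions, backward iterates the left loop, and the interior is invariant. -/
theorem exists_mem_interior_not_isRecurrentPoint (q : J × Bool) {i : ℕ} (hi : i < 4 * T.N) :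
    ∃ x ∈ interior {y | ¬ IsRecurrentPoint g y}, T.cell x = (q, i) := by
  obtain ⟨y, hy, hy'⟩ := T.exists_pos_eq q
  have hyW : y ∈ interior {y | ¬ IsRecurrentPoint g y} :=
    mem_interior.2 ⟨{y | T.pos y = T.N}, fun z hz => T.not_isRecurrentPoint_of_pos_eq hz,
      T.pos_locallyConstant.isOpen_fiber _, hy'⟩
  rcases le_total T.N i with hNi | hiN
  · refine ⟨g^[i - T.N] y, ?_, Prod.ext ((T.comp_iterate _ _).trans hy) ?_⟩
    · generalize i - T.N = n
      induction n with
      | zero => exact hyW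
      | succ n ih =>
        rwa [Function.iterate_succ_apply', g.apply_mem_interior_not_isRecurrentPoint_iff]
    · exact (T.pos_iterate_of_pos_eq hy' (by omega)).trans (by omega)
  · refine ⟨g.symm^[T.N - i] y, ?_, Prod.ext ((T.comp_symm_iterate _ _).trans hy)
      (T.pos_symm_iterate (by omega) (by omega))⟩
    generalize T.N - i = n
    induction n with
    | zero => exact hyW
    | succ n ih =>
      rwa [Function.iterate_succ_apply', ← g.apply_mem_interior_not_isRecurrentPoint_iff,
        g.apply_symm_apply]

/-! ### Repeller boundaries and failure of equicontinuity -/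

/-- The boundary of the repeller of the dumbbell `q`: the points that stay in the left loop
and are limits of points that leave it. -/
def repellerBoundary (q : J × Bool) : Set X :=
  {x | T.comp x = q ∧ (∀ n, T.pos (g^[n] x) < T.N) ∧
    x ∈ closure {z | T.comp z = q ∧ ∃ n, T.N ≤ T.pos (g^[n] z)}}

/-- Pull a point at position `N` back around the left loop `k` more times: the preimages need ever
longer to leave, so a limit point never does. -/
theorem exists_mem_left_loop [CompactSpace X] (q : J × Bool) {i : ℕ} (hi : i < T.N) :
    ∃ x, T.cell x = (q, i) ∧ (∀ n, T.pos (g^[n] x) < T.N) ∧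
      x ∈ closure {z | T.cell z = (q, i) ∧ ∃ n, T.pos (g^[n] z) = T.N} := by
  obtain ⟨y, hy, hy'⟩ := T.exists_pos_eq q
  let z : ℕ → X := fun k => g.symm^[T.N - i + k * T.N] y
  have hz : ∀ k, T.cell (z k) = (q, i) := fun k =>
    Prod.ext ((T.comp_symm_iterate _ _).trans hy) (T.pos_symm_iterate_add_mul hi hy' k)
  have hgz : ∀ k n, n ≤ k → T.pos (g^[n] (z k)) < T.N := by
    intro k n hnk
    have hk : k ≤ k * T.N := Nat.le_mul_of_pos_right k T.N_pos
    obtain ⟨m, hm⟩ := Nat.exists_eq_add_of_le (show n ≤ T.N - i + k * T.N by omega)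
    simp only [z]
    rw [hm, Function.iterate_add_apply,
      (Function.LeftInverse.iterate g.apply_symm_apply n) (g.symm^[m] y)]
    exact T.pos_symm_iterate_lt hy' (by omega)
  obtain ⟨x, φ, hφ, hx⟩ := CompactSpace.tendsto_subseq z
  refine ⟨x, ?_, fun n => ?_, ?_⟩
  · obtain ⟨k, hk⟩ := (hx.eventually (T.cell_locallyConstant.eventually_eq x)).exists
    rw [← hk]
    exact hz _
  · have h1 := ((g.continuous.iterate n).tendsto x).comp hx
    obtain ⟨k, hk, hk'⟩ := ((h1.eventually (T.pos_locallyConstant.eventually_eq _)).and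
      (eventually_ge_atTop n)).exists
    rw [← hk]
    exact hgz _ _ (hk'.trans hφ.le_apply)
  · refine mem_closure_of_tendsto hx (Eventually.of_forall fun k => ⟨hz _, ?_⟩)
    refine ⟨T.N - i + φ k * T.N, ?_⟩
    simp only [Function.comp_apply, z]
    rw [(Function.LeftInverse.iterate g.apply_symm_apply _) y, hy']

theorem repellerBoundary_nonempty [CompactSpace X] (q : J × Bool) :
    (T.repellerBoundary q).Nonempty := by
  obtain ⟨x, h1, h2, h3⟩ := T.exists_mem_left_loop q T.N_pos
  refine ⟨x, congrArg Prod.fst h1, h2, closure_mono ?_ h3⟩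
  rintro z ⟨hz, n, hn⟩
  exact ⟨congrArg Prod.fst hz, n, hn.ge⟩

theorem isClosed_repellerBoundary (q : J × Bool) : IsClosed (T.repellerBoundary q) := by
  refine (T.comp_locallyConstant.isClosed_fiber q).inter (IsClosed.inter ?_ isClosed_closure)
  change IsClosed {x | ∀ n, T.pos (g^[n] x) < T.N}
  rw [ofPred_forall]
  refine isClosed_iInter fun n => ?_
  let _ : TopologicalSpace ℕ := ⊥
  exact (isClosed_discrete {k | k < T.N}).preimage
    (T.pos_locallyConstant.continuous.comp (g.continuous.iterate n))

/-- A repeller boundary point is approximated by repeller boundary points lying in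
the twins of finer dumbbells. -/
theorem preperfect_repellerBoundary [CompactSpace X]
    (hT : ∀ δ > 0, ∃ J' : Type, Nonempty (TwinDumbbells g δ J')) (q : J × Bool) :
    Preperfect (T.repellerBoundary q) := by
  intro x hx
  rw [accPt_iff_nhds]
  intro U hU
  obtain ⟨r, hr, hrU⟩ := Metric.mem_nhds_iff.1 hU
  obtain ⟨δ, hδ, H⟩ := T.cell_locallyConstant.exists_eq_of_dist_lt
  have Hpos : ∀ {u v}, dist u v < δ → T.pos u = T.pos v := fun h => congrArg Prod.snd (H _ _ h)
  have Hcomp : ∀ {u v}, dist u v < δ → T.comp u = T.comp v := fun h => congrArg Prod.fst (H _ _ h)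
  obtain ⟨J', ⟨S⟩⟩ := hT (min r δ) (lt_min hr hδ)
  have hSr : ∀ {u v}, (S.comp u).1 = (S.comp v).1 → S.pos u = S.pos v → dist u v < r :=
    fun h1 h2 => (S.dist_lt _ _ h1 h2).trans_le (min_le_left _ _)
  have hSδ : ∀ {u v}, (S.comp u).1 = (S.comp v).1 → S.pos u = S.pos v → dist u v < δ :=
    fun h1 h2 => (S.dist_lt _ _ h1 h2).trans_le (min_le_right _ _)
  obtain ⟨hxq, hxN, hxc⟩ := hx
  rw [mem_closure_iff_frequently] at hxc
  have hxS : ∀ n, S.pos (g^[n] x) < S.N := by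
    by_contra! hm
    obtain ⟨m, hm⟩ := hm
    obtain ⟨z, ⟨-, n, hn⟩, hz⟩ := (hxc.and_eventually
      (S.shadowsWithin g.continuous (lt_min hr hδ) hm).eventually_dist_lt).exists
    have := Hpos ((hz n).trans_le (min_le_right _ _))
    have := hxN n
    omega
  -- The orbit of `x` visits every cell of its left loop in `S`, so this loop and its twin both lie
  -- in the left loop of `T`.
  have hleft : ∀ z, (S.comp z).1 = (S.comp x).1 → S.pos z < S.N → T.pos z < T.N := by
    intro z h1 h2
    obtain ⟨m, hm⟩ := S.exists_pos_iterate_eq hxS h2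
    rw [Hpos (hSδ (v := g^[m] x) (by rw [h1, S.comp_iterate]) hm.symm)]
    exact hxN m
  obtain ⟨z, ⟨-, n, hn⟩, hz⟩ :=
    (hxc.and_eventually (S.cell_locallyConstant.eventually_eq x)).exists
  have hzc : S.comp z = S.comp x := congrArg Prod.fst hz
  have hzN : S.N ≤ S.pos (g^[n] z) := by
    by_contra! hlt
    have := hleft (g^[n] z) (by rw [S.comp_iterate, hzc]) hlt
    omega
  -- Taking the point in the twin keeps it close to `x` but distinct from it.
  obtain ⟨x', h1, h2, h3⟩ := S.exists_mem_left_loop ((S.comp x).1, !(S.comp x).2) (hxS 0)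
  have hc' : S.comp x' = ((S.comp x).1, !(S.comp x).2) := congrArg Prod.fst h1
  have hp' : S.pos x' = S.pos x := congrArg Prod.snd h1
  refine ⟨x', ⟨hrU (hSr (by rw [hc']) hp'), ?_, fun k => ?_, closure_mono ?_ h3⟩, ?_⟩
  · rw [← hxq]
    exact Hcomp (hSδ (by rw [hc']) hp')
  · exact hleft _ (by rw [S.comp_iterate, hc']) (h2 k)
  · rintro w ⟨hw, m, hm⟩
    have hwc : S.comp w = ((S.comp x).1, !(S.comp x).2) := congrArg Prod.fst hw
    have hwp : S.pos w = S.pos x := congrArg Prod.snd hw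
    -- After `m` steps `w` is at position `S.N`; it then advances to the twin of the cell in which
    -- `z` was seen outside the left loop of `T`.
    refine ⟨?_, S.pos (g^[n] z) - S.N + m, ?_⟩
    · rw [← hxq]
      exact Hcomp (hSδ (by rw [hwc]) hwp)
    · have hlt := S.pos_lt (g^[n] z)
      have hpos := S.pos_iterate_of_pos_eq hm (n := S.pos (g^[n] z) - S.N) (by omega)
      rw [← Function.iterate_add_apply] at hpos
      rw [Hpos (hSδ (v := g^[n] z) ?_ ?_)]
      · exact hn
      · rw [S.comp_iterate, S.comp_iterate, hwc, hzc]
      · omega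
  · rintro rfl
    have := congrArg Prod.snd hc'
    simp at this

/-- Arbitrarily close points leave the left loop while `x` does not, and distinct cells are a
positive distance apart. -/
theorem not_equicontinuousAt_of_mem_repellerBoundary [CompactSpace X] {q : J × Bool}
    (hx : x ∈ T.repellerBoundary q) : ¬ EquicontinuousAt (fun (n : ℕ) (y : X) => g^[n] y) x := by
  intro heq
  obtain ⟨δ, hδ, H⟩ := T.cell_locallyConstant.exists_eq_of_dist_lt
  obtain ⟨-, hxN, hxc⟩ := hx
  rw [mem_closure_iff_frequently] at hxc
  obtain ⟨z, ⟨-, n, hn⟩, hz⟩ :=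
    (hxc.and_eventually (heq _ (Metric.dist_mem_uniformity hδ))).exists
  have h1 : T.pos (g^[n] x) = T.pos (g^[n] z) := congrArg Prod.snd (H _ _ (hz n))
  have := hxN n
  omega

end Homeo

end TwinDumbbells

/-! ### Uncountability and conclusion -/

theorem Perfect.not_countable {X : Type*} [MetricSpace X] [CompleteSpace X] {A : Set X}
    (hA : Perfect A) (hne : A.Nonempty) : ¬ A.Countable := by
  intro hc
  obtain ⟨f, hf, -, hinj⟩ := hA.exists_nat_bool_injection hne
  have : Countable A := hc
  have : Countable (ℕ → Bool) := (hinj.codRestrict fun x => hf ⟨x, rfl⟩).countable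
  obtain ⟨e, he⟩ := exists_surjective_nat (ℕ → Bool)
  obtain ⟨n, hn⟩ := he fun n => !e n n
  simpa using congrFun hn n

theorem mainTheorem10 (C : ConjClasses (Cantor ≃ₜ Cantor))
    (hC : C.carrier ∈ residual (Cantor ≃ₜ Cantor))
    (h : Cantor ≃ₜ Cantor) (hh : h ∈ C.carrier) :
    (∀ σ : Cantor, ¬ IsRecurrentPoint h σ → ChainContinuousAt h σ) ∧
    (∃ U : Set Cantor, IsOpen U ∧ Dense U ∧ ∀ σ ∈ U, ChainContinuousAt h σ) ∧
    (∃ A : Set Cantor, ¬ A.Countable ∧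
      ∀ σ ∈ A, ¬ EquicontinuousAt (fun (n : ℕ) (τ : Cantor) => h^[n] τ) σ) := by
  have hT : ∀ ε > 0, ∃ J : Type, Nonempty (TwinDumbbells h ε J) := fun ε hε =>
    exists_twinDumbbells_of_residual hC hh hε
  have hcc : ∀ σ : Cantor, ¬ IsRecurrentPoint h σ → ChainContinuousAt h σ := by
    intro σ hσ ε hε
    simp only [isRecurrentPoint_iff, not_forall, not_frequently] at hσ
    obtain ⟨U, hU, hσU⟩ := hσ
    obtain ⟨r, hr, hrU⟩ := Metric.mem_nhds_iff.1 hU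
    obtain ⟨M, hM⟩ := eventually_atTop.1 hσU
    -- Scale `r` forces the orbit of `σ` out of the left loop, since it eventually avoids the
    -- `r`-ball; scale `ε` gives the required closeness.
    obtain ⟨J, ⟨T⟩⟩ := hT (min ε r) (lt_min hε hr)
    obtain ⟨m, hm⟩ := T.exists_le_pos_of_dist_le (M := M) (x := σ) fun n hn => by
      by_contra! hlt
      exact hM n hn (hrU (hlt.trans_le (min_le_right _ _)))
    obtain ⟨δ, hδ, H⟩ := T.shadowsWithin h.continuous (lt_min hε hr) hm
    exact ⟨δ, hδ, fun u h0 hu n => (H u h0 hu n).trans_le (min_le_left _ _)⟩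
  refine ⟨hcc, ⟨interior {σ | ¬ IsRecurrentPoint h σ}, isOpen_interior, ?_,
    fun σ hσ => hcc σ (interior_subset hσ)⟩, ?_⟩
  · rw [Metric.dense_iff]
    intro σ r hr
    obtain ⟨J, ⟨T⟩⟩ := hT r hr
    obtain ⟨τ, hτ, hcell⟩ := T.exists_mem_interior_not_isRecurrentPoint (T.comp σ) (T.pos_lt σ)
    exact ⟨τ, T.dist_lt_of_cell_eq hcell, hτ⟩
  · obtain ⟨J, ⟨T⟩⟩ := hT 1 one_pos
    let q := T.comp fun _ => false
    exact ⟨T.repellerBoundary q,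
      Perfect.not_countable ⟨T.isClosed_repellerBoundary q, T.preperfect_repellerBoundary hT q⟩
        (T.repellerBoundary_nonempty q),
      fun σ hσ => T.not_equicontinuousAt_of_mem_repellerBoundary hσ⟩
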